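/- For a topological space $X$, let $PX$ denote the space of continuous paths $\gamma:[0,1]\to X$ with the compact-open topology and let $\pi:PX\to X\times X$ be the map $\pi(\gamma)=(\gamma(0),\gamma(1))$. The topological complexity $\mathrm{TC}(X)$ is the smallest integer $m$ such that $X\times X$ can be covered by $m$ open sets $U_1,\dots,U_m$, each of which admits a continuous map $s_i:U_i\to PX$ with $\pi\circ s_i=\mathrm{id}_{U_i}$ (and $\mathrm{TC}(X)=\infty$ if no such $m$ exists). Let $\mathbf{RP}^n$ be the space of lines through the origin of $\mathbf R^{n+1}$, with its standard smooth structure. **Theorem 8.1.** Suppose that the projective space $\mathbf{RP}^n$ can be (smoothly) immersed into $\mathbf R^k$. Then $$\mathrm{TC}(\mathbf{RP}^n)\leq k+1,$$ that is, $\mathbf{RP}^n\times\mathbf{RP}^n$ has an open cover by $k+1$ sets, each carrying a continuous section of $\pi$. -/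

import Mathlib

open scoped Manifold ContDiff LinearAlgebra.Projectivization

noncomputable section

/-! ### Topological complexity -/

/-- `X × X` can be covered by `m` open sets, each of which carries a continuous section of the
end-point map `C([0,1], X) → X × X`, `γ ↦ (γ 0, γ 1)`.  The path space `C(unitInterval, X)` has
the compact-open topology. -/
def HasMotionPlanningCover (X : Type*) [TopologicalSpace X] (m : ℕ) : Prop :=
  ∃ U : Fin m → Set (X × X),
    (∀ i, IsOpen (U i)) ∧ (⋃ i, U i) = Set.univ ∧
      ∀ i, ∃ s : U i → C(unitInterval, X), Continuous s ∧
        ∀ p : U i, (s p 0, s p 1) = (p : X × X)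

/-- The (unreduced) topological complexity: the smallest `m` for which `X × X` has an open cover
by `m` sets with continuous motion planning rules, and `⊤` if there is no such `m`. -/
def topologicalComplexity (X : Type*) [TopologicalSpace X] : ℕ∞ :=
  sInf {c : ℕ∞ | ∃ m : ℕ, c = (m : ℕ∞) ∧ HasMotionPlanningCover X m}

/-! ### Real projective space as a smooth manifold -/

/-- Real projective `n`-space: the space of lines through the origin in `ℝ^(n+1)`. -/
def RealProjectiveSpace (n : ℕ) : Type := ℙ ℝ (EuclideanSpace ℝ (Fin (n + 1)))

namespace RealProjectiveSpace

variable {n : ℕ}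

/-- The line spanned by a nonzero vector. -/
def proj (v : {v : EuclideanSpace ℝ (Fin (n + 1)) // v ≠ 0}) : RealProjectiveSpace n :=
  Projectivization.mk' ℝ v

/-- The quotient topology coming from `ℝ^(n+1) ∖ {0}`. -/
instance : TopologicalSpace (RealProjectiveSpace n) :=
  TopologicalSpace.coinduced proj inferInstance

theorem proj_surjective : Function.Surjective (proj (n := n)) := fun x => Quotient.exists_rep x

theorem isQuotientMap_proj : Topology.IsQuotientMap (proj (n := n)) :=
  ⟨⟨rfl⟩, proj_surjective⟩

theorem proj_eq_iff (v w : {v : EuclideanSpace ℝ (Fin (n + 1)) // v ≠ 0}) :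
    proj v = proj w ↔ ∃ a : ℝ, a • (w : EuclideanSpace ℝ (Fin (n + 1))) = v :=
  Projectivization.mk_eq_mk_iff' ℝ v.1 w.1 v.2 w.2

/-- The lines `[x₀ : ⋯ : xₙ]` with `xᵢ ≠ 0`. -/
def affineSet (i : Fin (n + 1)) : Set (RealProjectiveSpace n) :=
  {p | ∃ v, proj v = p ∧ v.1 i ≠ 0}

theorem proj_mem_affineSet (i : Fin (n + 1)) (v : {v : EuclideanSpace ℝ (Fin (n + 1)) // v ≠ 0}) :
    proj v ∈ affineSet i ↔ v.1 i ≠ 0 := by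
  refine ⟨?_, fun h => ⟨v, rfl, h⟩⟩
  rintro ⟨w, hw, hwi⟩ h0
  obtain ⟨a, ha⟩ := (proj_eq_iff w v).1 hw
  apply hwi
  rw [← ha]
  simp [h0]

theorem isOpen_affineSet (i : Fin (n + 1)) : IsOpen (affineSet i) := by
  rw [← isQuotientMap_proj.isOpen_preimage]
  have h : proj ⁻¹' affineSet i =
      {v : {v : EuclideanSpace ℝ (Fin (n + 1)) // v ≠ 0} | v.1 i ≠ 0} := by
    ext v
    exact proj_mem_affineSet i v
  rw [h]
  exact isOpen_ne_fun (by fun_prop) continuous_const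

/-- The affine coordinates `(x_j / x_i)_{j ≠ i}` of `[x₀ : ⋯ : xₙ]`. -/
def affineCoord (i : Fin (n + 1)) (p : RealProjectiveSpace n) : EuclideanSpace ℝ (Fin n) :=
  Projectivization.lift (K := ℝ) (V := EuclideanSpace ℝ (Fin (n + 1)))
    (fun v => WithLp.toLp 2 fun j => v.1 (i.succAbove j) / v.1 i)
    (by
      rintro ⟨a, ha⟩ ⟨b, hb⟩ t h
      have h' : a = t • b := h
      have ht : t ≠ 0 := by
        rintro rfl
        exact ha (by simpa using h')
      subst h'
      ext j
      simp [mul_div_mul_left _ _ ht]) p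

theorem affineCoord_proj (i : Fin (n + 1)) (v : {v : EuclideanSpace ℝ (Fin (n + 1)) // v ≠ 0}) :
    affineCoord i (proj v) = WithLp.toLp 2 fun j => v.1 (i.succAbove j) / v.1 i := rfl

/-- The vector with `i`-th coordinate `1` and remaining coordinates `u`. -/
def affineVec (i : Fin (n + 1)) (u : EuclideanSpace ℝ (Fin n)) :
    EuclideanSpace ℝ (Fin (n + 1)) :=
  WithLp.toLp 2 (i.insertNth (α := fun _ => ℝ) 1 u)

@[simp] theorem affineVec_same (i : Fin (n + 1)) (u : EuclideanSpace ℝ (Fin n)) :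
    affineVec i u i = 1 := by simp [affineVec]

@[simp] theorem affineVec_succAbove (i : Fin (n + 1)) (u : EuclideanSpace ℝ (Fin n)) (j : Fin n) :
    affineVec i u (i.succAbove j) = u j := by simp [affineVec]

theorem affineVec_ne_zero (i : Fin (n + 1)) (u : EuclideanSpace ℝ (Fin n)) :
    affineVec i u ≠ 0 := by
  intro h
  have h1 := affineVec_same i u
  rw [h] at h1
  simp at h1

theorem contDiff_affineVec {m : ℕ∞ω} (i : Fin (n + 1)) :
    ContDiff ℝ m (affineVec (n := n) i) := by
  rw [contDiff_euclidean]
  intro l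
  refine Fin.succAboveCases i ?_ (fun j => ?_) l
  · simp only [affineVec_same]
    exact contDiff_const
  · simp only [affineVec_succAbove]
    fun_prop

/-- The standard affine chart `[x₀ : ⋯ : xₙ] ↦ (x_j / x_i)_{j ≠ i}` on `{x_i ≠ 0}`. -/
def affineChart (i : Fin (n + 1)) :
    OpenPartialHomeomorph (RealProjectiveSpace n) (EuclideanSpace ℝ (Fin n)) where
  toFun := affineCoord i
  invFun u := proj ⟨affineVec i u, affineVec_ne_zero i u⟩
  source := affineSet i
  target := Set.univ
  map_source' _ _ := Set.mem_univ _
  map_target' u _ := (proj_mem_affineSet i _).2 (by simp)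
  left_inv' p hp := by
    obtain ⟨v, rfl⟩ := proj_surjective p
    have hv := (proj_mem_affineSet i v).1 hp
    rw [proj_eq_iff]
    refine ⟨(v.1 i)⁻¹, ?_⟩
    ext l
    refine Fin.succAboveCases i ?_ (fun j => ?_) l
    · simp [hv]
    · simp [affineCoord_proj, div_eq_inv_mul]
  right_inv' u _ := by
    rw [affineCoord_proj]
    ext j
    simp
  open_source := isOpen_affineSet i
  open_target := isOpen_univ
  continuousOn_toFun := by
    rw [isQuotientMap_proj.continuousOn_isOpen_iff (isOpen_affineSet i)]
    have h : ∀ j : Fin n, ContinuousOn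
        (fun v : {v : EuclideanSpace ℝ (Fin (n + 1)) // v ≠ 0} => v.1 (i.succAbove j) / v.1 i)
        (proj ⁻¹' affineSet i) := fun j =>
      ContinuousOn.div (by fun_prop) (by fun_prop) fun v hv => (proj_mem_affineSet i v).1 hv
    exact (PiLp.continuous_toLp 2 _).comp_continuousOn (continuousOn_pi.2 h)
  continuousOn_invFun := by
    refine Continuous.continuousOn (isQuotientMap_proj.continuous.comp ?_)
    exact Continuous.subtype_mk (contDiff_affineVec (m := 0) i).continuous _

theorem exists_mem_affineSet (p : RealProjectiveSpace n) : ∃ i, p ∈ affineSet i := by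
  obtain ⟨v, rfl⟩ := proj_surjective p
  by_contra! h
  apply v.2
  ext i
  simpa [proj_mem_affineSet] using h i

/-- The standard atlas, consisting of the `n + 1` affine charts. -/
instance : ChartedSpace (EuclideanSpace ℝ (Fin n)) (RealProjectiveSpace n) where
  atlas := Set.range affineChart
  chartAt p := affineChart (exists_mem_affineSet p).choose
  mem_chart_source p := (exists_mem_affineSet p).choose_spec
  chart_mem_atlas _ := Set.mem_range_self _

instance {m : ℕ∞ω} : IsManifold (𝓡 n) m (RealProjectiveSpace n) := by
  refine isManifold_of_contDiffOn (𝓡 n) m _ ?_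
  rintro _ _ ⟨i, rfl⟩ ⟨j, rfl⟩
  have hc : ∀ l, ContDiff ℝ m fun u : EuclideanSpace ℝ (Fin n) => affineVec i u l :=
    fun l => contDiff_euclidean.1 (contDiff_affineVec i) l
  have h : ContDiffOn ℝ m (fun u : EuclideanSpace ℝ (Fin n) =>
      (WithLp.toLp 2 fun l => affineVec i u (j.succAbove l) / affineVec i u j :
        EuclideanSpace ℝ (Fin n))) {u | affineVec i u j ≠ 0} := by
    rw [contDiffOn_euclidean]
    exact fun l => ContDiffOn.div (hc _).contDiffOn (hc _).contDiffOn fun u hu => hu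
  refine h.mono ?_
  intro u hu
  simp only [mfld_simps] at hu
  exact (proj_mem_affineSet j _).1 hu.2

end RealProjectiveSpace

end

namespace RealProjectiveSpace

open Topology Filter

variable {n : ℕ}

/-! Moving from a line to another amounts to choosing consistently between `w` and `-w` once a
representative `v` is fixed. A continuous function `lam v w` of bidegree (1, 1) makes this choice
wherever it is nonzero: join `v` to `lam v w • w` by a segment
(`exists_motionPlanner_of_bihomogeneous`). An immersion `f` provides `k` such functions. Its
pullback `F` to nonzero vectors has degree 0, so `‖v‖² dF_i(v) w` has bidegree (1, 1); the inner
product is one more. Since `f` is an immersion, the kernel of `dF(v)` is spanned by `v`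
(`exists_smul_eq_of_fderiv_pullback_eq_zero`). If all `k` derivatives vanish, `w` is a nonzero
multiple of `v`, so the inner product is nonzero. Hence the `k + 1` open sets cover. -/

theorem proj_smul_eq {v w : {v : EuclideanSpace ℝ (Fin (n + 1)) // v ≠ 0}} {a : ℝ}
    (h : v.1 = a • w.1) : proj v = proj w :=
  (proj_eq_iff v w).2 ⟨a, h.symm⟩

theorem exists_ne_zero_smul_eq_of_proj_eq {v w : {v : EuclideanSpace ℝ (Fin (n + 1)) // v ≠ 0}}
    (h : proj v = proj w) : ∃ a : ℝ, a ≠ 0 ∧ v.1 = a • w.1 := by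
  obtain ⟨a, ha⟩ := (proj_eq_iff v w).1 h
  refine ⟨a, ?_, ha.symm⟩
  rintro rfl
  exact v.2 (by simpa using ha.symm)

/-- The saturation of an open set is the union of its preimages under nonzero scalings. Openness
matters because products and restrictions of open quotient maps are again quotient maps. -/
theorem isOpenQuotientMap_proj : IsOpenQuotientMap (proj (n := n)) := by
  refine .of_isOpenMap_isQuotientMap (fun V hV => ?_) isQuotientMap_proj
  rw [← isQuotientMap_proj.isOpen_preimage]
  have h : proj ⁻¹' (proj '' V) = ⋃ a : {a : ℝ // a ≠ 0},
      (fun w : {v : EuclideanSpace ℝ (Fin (n + 1)) // v ≠ 0} =>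
        (⟨a.1 • w.1, smul_ne_zero a.2 w.2⟩ :
          {v : EuclideanSpace ℝ (Fin (n + 1)) // v ≠ 0})) ⁻¹' V := by
    ext w
    simp only [Set.mem_preimage, Set.mem_image, Set.mem_iUnion]
    constructor
    · rintro ⟨v, hv, hvw⟩
      obtain ⟨a, ha, h⟩ := exists_ne_zero_smul_eq_of_proj_eq hvw
      refine ⟨⟨a, ha⟩, ?_⟩
      convert hv
      exact h.symm
    · rintro ⟨a, ha⟩
      exact ⟨_, ha, proj_smul_eq rfl⟩
  rw [h]
  exact isOpen_iUnion fun a => hV.preimage (by fun_prop)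

/-! ### Motion planners from bihomogeneous functions -/

/-- A continuous function of two nonzero vectors, homogeneous of bidegree `(1, 1)`, yields a motion
planner on the set of pairs of lines where it does not vanish, by moving along the segment from
`‖w‖² v` to `lam v w • w`, as soon as this segment avoids the origin. -/
theorem exists_motionPlanner_of_bihomogeneous
    (lam : {v : EuclideanSpace ℝ (Fin (n + 1)) // v ≠ 0} →
      {v : EuclideanSpace ℝ (Fin (n + 1)) // v ≠ 0} → ℝ)
    (hcont : Continuous fun z : _ × _ => lam z.1 z.2)
    (hhom : ∀ v w v' w' (a b : ℝ), a ≠ 0 → b ≠ 0 → v'.1 = a • v.1 → w'.1 = b • w.1 →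
      lam v' w' = a * b * lam v w)
    (hne : ∀ v w, lam v w ≠ 0 → ∀ t ∈ Set.Icc (0 : ℝ) 1,
      ((1 - t) * ‖w.1‖ ^ 2) • v.1 + (t * lam v w) • w.1 ≠ 0) :
    ∃ U : Set (RealProjectiveSpace n × RealProjectiveSpace n), IsOpen U ∧
      (∀ v w, (proj v, proj w) ∈ U ↔ lam v w ≠ 0) ∧
      ∃ s : U → C(unitInterval, RealProjectiveSpace n), Continuous s ∧
        ∀ p : U, (s p 0, s p 1) = (p : RealProjectiveSpace n × RealProjectiveSpace n) := by
  set q := Prod.map (proj (n := n)) (proj (n := n)) with hq_def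
  have hq : IsOpenQuotientMap q := isOpenQuotientMap_proj.prodMap isOpenQuotientMap_proj
  set U := q '' {z | lam z.1 z.2 ≠ 0} with hU_def
  have hUopen : IsOpen U := hq.isOpenMap _ (isOpen_ne_fun hcont continuous_const)
  have hU : ∀ v w, (proj v, proj w) ∈ U ↔ lam v w ≠ 0 := by
    refine fun v w => ⟨?_, fun h => ⟨(v, w), h, rfl⟩⟩
    rintro ⟨⟨v', w'⟩, h, heq⟩ h0
    obtain ⟨a, ha, hva⟩ := exists_ne_zero_smul_eq_of_proj_eq (Prod.ext_iff.1 heq).1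
    obtain ⟨b, hb, hwb⟩ := exists_ne_zero_smul_eq_of_proj_eq (Prod.ext_iff.1 heq).2
    apply h
    simp [hhom v w v' w' a b ha hb hva hwb, h0]
  let P : q ⁻¹' U × unitInterval → RealProjectiveSpace n := fun z =>
    proj ⟨((1 - (z.2 : ℝ)) * ‖z.1.1.2.1‖ ^ 2) • z.1.1.1.1 +
      ((z.2 : ℝ) * lam z.1.1.1 z.1.1.2) • z.1.1.2.1,
      hne _ _ ((hU _ _).1 z.1.2) _ z.2.2⟩
  have hPcont : Continuous P := by
    refine isQuotientMap_proj.continuous.comp (Continuous.subtype_mk ?_ _)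
    have : Continuous fun z : q ⁻¹' U × unitInterval => lam z.1.1.1 z.1.1.2 :=
      hcont.comp (continuous_subtype_val.comp continuous_fst)
    fun_prop
  let r := U.restrictPreimage q
  have hr : IsOpenQuotientMap r := hq.restrictPreimage U
  have hP : ∀ z z' t, r z = r z' → P (z, t) = P (z', t) := by
    rintro ⟨⟨v', w'⟩, h'⟩ ⟨⟨v, w⟩, h⟩ t heq
    have heq' := congrArg Subtype.val heq
    obtain ⟨a, ha, hva⟩ := exists_ne_zero_smul_eq_of_proj_eq (Prod.ext_iff.1 heq').1
    obtain ⟨b, hb, hwb⟩ := exists_ne_zero_smul_eq_of_proj_eq (Prod.ext_iff.1 heq').2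
    -- The factor `‖w‖²` makes both ends of the segment scale by `a * b ^ 2`: the first by `b ^ 2 *
    -- a`, the second by `(a * b) * b`.
    refine proj_smul_eq (a := a * b ^ 2) ?_
    simp only [hhom v w v' w' a b ha hb hva hwb]
    change v'.1 = a • v.1 at hva
    change w'.1 = b • w.1 at hwb
    rw [hva, hwb, norm_smul, mul_pow, Real.norm_eq_abs, sq_abs]
    module
  let s : U → C(unitInterval, RealProjectiveSpace n) := fun p =>
    ⟨fun t => P (Function.surjInv hr.surjective p, t), by fun_prop⟩
  refine ⟨U, hUopen, hU, s, ?_, ?_⟩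
  · apply ContinuousMap.continuous_of_continuous_uncurry
    -- The chosen representatives need not vary continuously, so continuity is checked upstairs,
    -- where the map agrees with `P`.
    rw [← (hr.prodMap IsOpenQuotientMap.id).continuous_comp_iff]
    refine hPcont.congr fun z => ?_
    exact hP _ _ _ (Function.surjInv_eq hr.surjective (r z.1)).symm
  · intro p
    obtain ⟨z, rfl⟩ := hr.surjective p
    have hs : ∀ t, s (r z) t = P (z, t) := fun t =>
      hP _ _ _ (Function.surjInv_eq hr.surjective (r z))
    rw [hs, hs]
    refine Prod.ext ?_ ?_
    · exact proj_smul_eq (a := ‖z.1.2.1‖ ^ 2) (by simp)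
    · exact proj_smul_eq (a := lam z.1.1 z.1.2) (by simp)

/-- The pullback of a map on projective space to nonzero vectors, with value `0` at the origin. -/
noncomputable def pullback {k : ℕ} (f : RealProjectiveSpace n → EuclideanSpace ℝ (Fin k))
    (x : EuclideanSpace ℝ (Fin (n + 1))) : EuclideanSpace ℝ (Fin k) :=
  open scoped Classical in if h : x ≠ 0 then f (proj ⟨x, h⟩) else 0

/-! ### Pullback of a map to nonzero vectors -/

section pullback

variable {k : ℕ} {f : RealProjectiveSpace n → EuclideanSpace ℝ (Fin k)}

theorem pullback_apply (v : {v : EuclideanSpace ℝ (Fin (n + 1)) // v ≠ 0}) :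
    pullback f v.1 = f (proj v) := by
  simp [pullback, v.2]

theorem pullback_smul {a : ℝ} (ha : a ≠ 0) (x : EuclideanSpace ℝ (Fin (n + 1))) :
    pullback f (a • x) = pullback f x := by
  by_cases hx : x = 0
  · simp [hx]
  · have h := pullback_apply (f := f) ⟨a • x, smul_ne_zero ha hx⟩
    have h' := pullback_apply (f := f) ⟨x, hx⟩
    simp only at h h'
    rw [h, h']
    exact congrArg f (proj_smul_eq rfl)

/-- The derivative of a function of degree 0 has degree -1. -/
theorem smul_fderiv_pullback_smul {a : ℝ} (ha : a ≠ 0) (x : EuclideanSpace ℝ (Fin (n + 1))) :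
    a • fderiv ℝ (pullback f) (a • x) = fderiv ℝ (pullback f) x := by
  rw [← fderiv_comp_smul]
  simp only [pullback_smul ha]

theorem affineChart_mem_maximalAtlas {m : ℕ∞ω} (i : Fin (n + 1)) :
    affineChart i ∈ IsManifold.maximalAtlas (𝓡 n) m (RealProjectiveSpace n) :=
  IsManifold.subset_maximalAtlas (Set.mem_range_self i)

theorem exists_coord_ne_zero (v : {v : EuclideanSpace ℝ (Fin (n + 1)) // v ≠ 0}) :
    ∃ i, v.1 i ≠ 0 := by
  obtain ⟨i, hi⟩ := exists_mem_affineSet (proj v)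
  exact ⟨i, (proj_mem_affineSet i v).1 hi⟩

theorem contDiffAt_pullback {m : ℕ∞ω} (hf : ContMDiff (𝓡 n) (𝓡 k) m f)
    (v : {v : EuclideanSpace ℝ (Fin (n + 1)) // v ≠ 0}) :
    ContDiffAt ℝ m (pullback f) v.1 := by
  obtain ⟨i, hi⟩ := exists_coord_ne_zero v
  let c : EuclideanSpace ℝ (Fin (n + 1)) → EuclideanSpace ℝ (Fin n) := fun x =>
    WithLp.toLp 2 fun j => x (i.succAbove j) / x i
  have hc : ContDiffAt ℝ m c v.1 := by
    rw [contDiffAt_euclidean]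
    exact fun j => ContDiffAt.div (by fun_prop) (by fun_prop) hi
  have hg : ContDiffAt ℝ m (f ∘ (affineChart i).symm) (c v.1) := by
    rw [← contMDiffAt_iff_contDiffAt]
    exact hf.contMDiffAt.comp _
      (contMDiffAt_symm_of_mem_maximalAtlas (affineChart_mem_maximalAtlas i) (Set.mem_univ _))
  refine (hg.comp v.1 hc).congr_of_eventuallyEq ?_
  have hev : ∀ᶠ x : EuclideanSpace ℝ (Fin (n + 1)) in 𝓝 v.1, x i ≠ 0 :=
    (isOpen_ne_fun (by fun_prop) continuous_const).mem_nhds hi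
  filter_upwards [hev] with x hx
  have hx0 : x ≠ 0 := by
    rintro rfl
    exact hx rfl
  have h := (affineChart i).left_inv ((proj_mem_affineSet i ⟨x, hx0⟩).2 hx)
  rw [pullback_apply ⟨x, hx0⟩, ← h]
  rfl

/-! ### The kernel of the differential of an immersion -/

/-- An immersion has a smooth local left inverse, here written in an affine chart. -/
theorem exists_local_leftInverse (p : RealProjectiveSpace n)
    (hf : Manifold.IsImmersionAt (𝓡 n) (𝓡 k) ∞ f p) (i : Fin (n + 1)) (hp : p ∈ affineSet i) :
    ∃ H : EuclideanSpace ℝ (Fin k) → EuclideanSpace ℝ (Fin n),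
      DifferentiableAt ℝ H (f p) ∧ ∀ᶠ x in 𝓝 p, affineCoord i x = H (f x) := by
  -- In the charts of the immersion `f` is `u ↦ (u, 0)`, so the first component recovers `u`.
  let G : EuclideanSpace ℝ (Fin k) → EuclideanSpace ℝ (Fin n) := fun y =>
    (hf.equiv.symm (hf.codChart y)).1
  have hG : ∀ x ∈ hf.domChart.source, G (f x) = hf.domChart x := by
    intro x hx
    have hx' : hf.domChart x ∈ (hf.domChart.extend (𝓡 n)).target := by
      simpa using hf.domChart.map_source hx
    have h := hf.writtenInCharts hx'
    have h' : hf.codChart (f x) = hf.equiv (hf.domChart x, 0) := by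
      simpa [hf.domChart.left_inv hx] using h
    simp [G, h']
  have hGd : ContDiffAt ℝ ∞ G (f p) := by
    have h : ContDiffAt ℝ ∞ hf.codChart (f p) := by
      rw [← contMDiffAt_iff_contDiffAt]
      exact contMDiffAt_of_mem_maximalAtlas hf.codChart_mem_maximalAtlas hf.mem_codChart_source
    exact contDiffAt_fst.comp _ (hf.equiv.symm.contDiff.contDiffAt.comp _ h)
  have hT : ContDiffAt ℝ ∞ (affineChart i ∘ hf.domChart.symm) (G (f p)) := by
    rw [← contMDiffAt_iff_contDiffAt, hG p hf.mem_domChart_source]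
    have h := hf.domChart.left_inv hf.mem_domChart_source
    refine ContMDiffAt.comp (I' := 𝓡 n) _ ?_ (contMDiffAt_symm_of_mem_maximalAtlas
      hf.domChart_mem_maximalAtlas (hf.domChart.map_source hf.mem_domChart_source))
    rw [h]
    exact contMDiffAt_of_mem_maximalAtlas (affineChart_mem_maximalAtlas i) hp
  refine ⟨(affineChart i ∘ hf.domChart.symm) ∘ G,
    (hT.comp _ hGd).differentiableAt (by simp), ?_⟩
  filter_upwards [hf.domChart.open_source.mem_nhds hf.mem_domChart_source] with x hx
  simp only [Function.comp_apply, hG x hx, hf.domChart.left_inv hx]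
  rfl

/-- The affine coordinates are locally differentiable functions of `F`, so their derivatives along
`w` vanish with that of `F`; the ratios of coordinates are then stationary, which forces `w` to be
parallel to `v`. -/
theorem exists_smul_eq_of_fderiv_pullback_eq_zero (hf : Manifold.IsImmersion (𝓡 n) (𝓡 k) ∞ f)
    (v : {v : EuclideanSpace ℝ (Fin (n + 1)) // v ≠ 0}) (w : EuclideanSpace ℝ (Fin (n + 1)))
    (hw : fderiv ℝ (pullback f) v.1 w = 0) : ∃ c : ℝ, w = c • v.1 := by
  obtain ⟨i, hi⟩ := exists_coord_ne_zero v
  obtain ⟨H, hH, hev⟩ := exists_local_leftInverse (proj v) (hf.isImmersionAt (proj v)) i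
    ((proj_mem_affineSet i v).2 hi)
  have hF : DifferentiableAt ℝ (pullback f) v.1 :=
    (contDiffAt_pullback hf.contMDiff v).differentiableAt (by simp)
  have hev' : ∀ᶠ x in 𝓝 v.1, ∀ j, x (i.succAbove j) / x i = H (pullback f x) j := by
    have h := isQuotientMap_proj.continuous.continuousAt.eventually hev
    rw [nhds_subtype_eq_comap, eventually_comap] at h
    have h0 : ∀ᶠ x in 𝓝 v.1, x ≠ 0 := isOpen_ne.mem_nhds v.2
    filter_upwards [h, h0] with x hx hx0 j
    rw [pullback_apply ⟨x, hx0⟩, ← hx ⟨x, hx0⟩ rfl]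
    rfl
  refine ⟨w i / v.1 i, ?_⟩
  have hcoord : ∀ j : Fin n, w (i.succAbove j) = w i / v.1 i * v.1 (i.succAbove j) := by
    intro j
    have hproj : ∀ l, HasFDerivAt (fun x : EuclideanSpace ℝ (Fin (n + 1)) => x l)
      (EuclideanSpace.proj (𝕜 := ℝ) l : EuclideanSpace ℝ (Fin (n + 1)) →L[ℝ] ℝ) v.1 :=
      fun l => (EuclideanSpace.proj (𝕜 := ℝ) l).hasFDerivAt
    rw [← pullback_apply (f := f) v] at hH
    have hcomp : HasFDerivAt (fun x => H (pullback f x) j)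
        ((EuclideanSpace.proj (𝕜 := ℝ) j).comp
          ((fderiv ℝ H (pullback f v.1)).comp (fderiv ℝ (pullback f) v.1))) v.1 :=
      (EuclideanSpace.proj (𝕜 := ℝ) j).hasFDerivAt.comp v.1
        (hH.hasFDerivAt.comp v.1 hF.hasFDerivAt)
    -- Clearing the denominator `x i` leaves only a product to differentiate.
    have hmul : HasFDerivAt (fun x : EuclideanSpace ℝ (Fin (n + 1)) => x i * H (pullback f x) j)
        _ v.1 := (hproj i).mul hcomp
    have hne : ∀ᶠ x : EuclideanSpace ℝ (Fin (n + 1)) in 𝓝 v.1, x i ≠ 0 :=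
      (isOpen_ne_fun (by fun_prop) continuous_const).mem_nhds hi
    have heq : (fun x : EuclideanSpace ℝ (Fin (n + 1)) => x (i.succAbove j)) =ᶠ[𝓝 v.1]
        fun x => x i * H (pullback f x) j := by
      filter_upwards [hev', hne] with x hx hxi
      rw [← hx j]
      field_simp
    have huniq := congrArg (fun L => L w) ((hproj _).unique (hmul.congr_of_eventuallyEq heq))
    rw [← hev'.self_of_nhds j] at huniq
    simp only [PiLp.proj_apply, _root_.add_apply, _root_.smul_apply,
      ContinuousLinearMap.comp_apply, hw, map_zero, smul_eq_mul] at huniq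
    rw [huniq]
    ring
  ext l
  refine Fin.succAboveCases i ?_ (fun j => ?_) l
  · simp [hi]
  · simpa using hcoord j

/-- Euler's relation in degree 0: `F` is constant along the ray through `v`. -/
theorem fderiv_pullback_self (hf : ContMDiff (𝓡 n) (𝓡 k) 1 f)
    (v : {v : EuclideanSpace ℝ (Fin (n + 1)) // v ≠ 0}) :
    fderiv ℝ (pullback f) v.1 v.1 = 0 := by
  have hF : DifferentiableAt ℝ (pullback f) ((1 : ℝ) • v.1) := by
    simpa using (contDiffAt_pullback hf v).differentiableAt (by simp)
  have h1 : HasDerivAt (fun a : ℝ => pullback f (a • v.1)) (fderiv ℝ (pullback f) v.1 v.1) 1 := by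
    have hl : HasDerivAt (fun a : ℝ => a • v.1) v.1 1 := by
      simpa using (hasDerivAt_id (1 : ℝ)).smul_const v.1
    simpa [Function.comp_def] using hF.hasFDerivAt.comp_hasDerivAt (1 : ℝ) hl
  have h2 : HasDerivAt (fun a : ℝ => pullback f (a • v.1)) 0 1 := by
    refine (hasDerivAt_const (1 : ℝ) (pullback f v.1)).congr_of_eventuallyEq ?_
    filter_upwards [isOpen_ne.mem_nhds (one_ne_zero' ℝ)] with a ha
    exact pullback_smul ha v.1
  exact h1.unique h2

/-! ### The `k + 1` motion planners -/

/-- The motion planner on pairs of non-orthogonal lines. -/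
theorem exists_motionPlanner_inner (n : ℕ) :
    ∃ U : Set (RealProjectiveSpace n × RealProjectiveSpace n), IsOpen U ∧
      (∀ v w, (proj v, proj w) ∈ U ↔ inner ℝ v.1 w.1 ≠ 0) ∧
      ∃ s : U → C(unitInterval, RealProjectiveSpace n), Continuous s ∧
        ∀ p : U, (s p 0, s p 1) = (p : RealProjectiveSpace n × RealProjectiveSpace n) := by
  refine exists_motionPlanner_of_bihomogeneous (fun v w => inner ℝ v.1 w.1) (by fun_prop) ?_ ?_
  · intro v w v' w' a b _ _ hv hw
    simp only [hv, hw, real_inner_smul_left, real_inner_smul_right]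
    ring
  · intro v w h t ht h0
    -- Pairing with `v` gives `(1 - t)‖w‖²‖v‖² + t⟨v, w⟩²`, which is positive on `[0, 1]`.
    have h1 := congrArg (inner ℝ v.1) h0
    simp only [inner_add_right, real_inner_smul_right, real_inner_self_eq_norm_sq,
      inner_zero_right] at h1
    have hv : 0 < ‖v.1‖ ^ 2 := by have := norm_pos_iff.2 v.2; positivity
    have hw : 0 < ‖w.1‖ ^ 2 := by have := norm_pos_iff.2 w.2; positivity
    have hl : 0 < (inner ℝ v.1 w.1) ^ 2 := by positivity
    have hvw := mul_pos hw hv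
    rcases ht.1.eq_or_lt with rfl | ht0
    · nlinarith
    · nlinarith [mul_pos ht0 hl, mul_nonneg (sub_nonneg.2 ht.2) hvw.le]

/-- The motion planner on pairs of lines on which the differential of a component is nonzero. -/
theorem exists_motionPlanner_fderiv (hf : ContMDiff (𝓡 n) (𝓡 k) 1 f) (i : Fin k) :
    ∃ U : Set (RealProjectiveSpace n × RealProjectiveSpace n), IsOpen U ∧
      (∀ v w, (proj v, proj w) ∈ U ↔ ‖v.1‖ ^ 2 * fderiv ℝ (pullback f) v.1 w.1 i ≠ 0) ∧
      ∃ s : U → C(unitInterval, RealProjectiveSpace n), Continuous s ∧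
        ∀ p : U, (s p 0, s p 1) = (p : RealProjectiveSpace n × RealProjectiveSpace n) := by
  refine exists_motionPlanner_of_bihomogeneous
    (fun v w => ‖v.1‖ ^ 2 * fderiv ℝ (pullback f) v.1 w.1 i) ?_ ?_ ?_
  · have hd : Continuous fun v : {v : EuclideanSpace ℝ (Fin (n + 1)) // v ≠ 0} =>
        fderiv ℝ (pullback f) v.1 := by
      rw [continuous_iff_continuousAt]
      exact fun v => ContinuousAt.comp (f := Subtype.val)
        ((contDiffAt_pullback hf v).continuousAt_fderiv one_ne_zero)
        continuous_subtype_val.continuousAt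
    have : Continuous fun z : {v : EuclideanSpace ℝ (Fin (n + 1)) // v ≠ 0} ×
        {v : EuclideanSpace ℝ (Fin (n + 1)) // v ≠ 0} =>
        fderiv ℝ (pullback f) z.1.1 z.2.1 :=
      (hd.comp continuous_fst).clm_apply (continuous_subtype_val.comp continuous_snd)
    fun_prop
  · intro v w v' w' a b ha _ hv hw
    simp only [hv, hw, ← smul_fderiv_pullback_smul (f := f) ha v.1, norm_smul, mul_pow,
      Real.norm_eq_abs, sq_abs, map_smul, _root_.smul_apply, PiLp.smul_apply,
      smul_eq_mul]
    ring
  · intro v w h t _ h0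
    -- `dF_i(v)` kills `v`, so only the `w` term survives; this forces `t = 0`, where the segment is
    -- at `‖w‖² v ≠ 0`.
    have h1 := congrArg (fun x => fderiv ℝ (pullback f) v.1 x i) h0
    simp only [map_add, map_smul, fderiv_pullback_self hf v, smul_zero, zero_add, map_zero,
      PiLp.smul_apply, PiLp.zero_apply, smul_eq_mul] at h1
    have ht : t = 0 := by
      have hd := right_ne_zero_of_mul h
      simpa [h, hd] using h1
    subst ht
    simp [v.2, w.2] at h0

end pullback

end RealProjectiveSpace

open RealProjectiveSpace in
theorem theorem8p1 (n k : ℕ)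
    (h : ∃ f : RealProjectiveSpace n → EuclideanSpace ℝ (Fin k),
      Manifold.IsImmersion (𝓡 n) (𝓡 k) ∞ f) :
    topologicalComplexity (RealProjectiveSpace n) ≤ (k : ℕ∞) + 1 := by
  obtain ⟨f, hf⟩ := h
  have hf1 : ContMDiff (𝓡 n) (𝓡 k) 1 f := hf.contMDiff.of_le (by simp)
  obtain ⟨U₀, hU₀, hmem₀, hs₀⟩ := exists_motionPlanner_inner n
  choose U hU hmem hs using exists_motionPlanner_fderiv hf1
  refine sInf_le ⟨k + 1, by simp, Fin.cons U₀ U, Fin.cases hU₀ hU, ?_, Fin.cases hs₀ hs⟩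
  refine Set.eq_univ_of_forall fun ⟨p, q⟩ => ?_
  obtain ⟨v, rfl⟩ := proj_surjective p
  obtain ⟨w, rfl⟩ := proj_surjective q
  by_contra hcon
  simp only [Set.mem_iUnion, not_exists, Fin.forall_fin_succ, Fin.cons_zero, Fin.cons_succ, hmem₀,
    hmem, not_not] at hcon
  obtain ⟨h0, h1⟩ := hcon
  obtain ⟨c, hc⟩ := exists_smul_eq_of_fderiv_pullback_eq_zero hf v w.1 (by
    ext i
    simpa [v.2] using h1 i)
  rw [hc, real_inner_smul_right, mul_eq_zero, inner_self_eq_zero] at h0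
  rcases h0 with rfl | h0
  · exact w.2 (by simpa using hc)
  · exact v.2 h0
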